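/- Let $0<\ell<1/2$ and $0<w<1/2$. A gambler with fortune $f\in[0,1]$ who plays boldly stakes $s(f)=\min\{\ell,f,1-f\}$ on each of a sequence of independent bets; a bet is won with probability $w$ (fortune becomes $f+s(f)$) and lost with probability $1-w$ (fortune becomes $f-s(f)$). Let $X_k$ be the fortune after $k$ bets, and for $f\in[0,1]$ let $Q(f)=P(X_k=1\text{ for some }k\ge 0\mid X_0=f)$; put $Q(f)=0$ for $f<0$. Let $$S=\{f\in[0,1] : P(X_k=1-\ell\text{ for some }k\ge 0\mid X_0=f)>0\}.$$ 1. If $f\in S$, then there is a constant $C>0$ such that $Q(f)-Q(f-\epsilon)\ge C(1-w)^{-\log_2\epsilon}$ for all $0<\epsilon<\ell$. 2. If $f\in[0,1)$ and $f\notin S$, then for every $C>0$ there is $\delta>0$ such that $Q(f)-Q(f-\epsilon)\le C(1-w)^{-\log_2\epsilon}$ for all $0<\epsilon<\delta$. 3. If $\ell$ is irrational, then there is $f\in(\ell,1-\ell)$ such that $f-\ell\in S$ and $f+\ell\notin S$. -/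

import Mathlib

open MeasureTheory

namespace BoldPlay

/-- The bold stake `min {ℓ, f, 1 - f}` of a gambler with fortune `f`
when at most `ℓ` may be staked. -/
noncomputable def stake (ℓ f : ℝ) : ℝ := min ℓ (min f (1 - f))

/-- The fortune after `k` bets of a gambler who starts with `f` and plays boldly;
`ω k = true` means that bet number `k + 1` is won. -/
noncomputable def fortune (ℓ f : ℝ) (ω : ℕ → Bool) : ℕ → ℝ
  | 0 => f
  | k + 1 =>
    if ω k = true then fortune ℓ f ω k + stake ℓ (fortune ℓ f ω k)
    else fortune ℓ f ω k - stake ℓ (fortune ℓ f ω k)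

/-- The law of a single bet: won with probability `w`, lost with probability `1 - w`. -/
noncomputable def betLaw (w : ℝ) : Measure Bool :=
  ENNReal.ofReal w • Measure.dirac true + ENNReal.ofReal (1 - w) • Measure.dirac false

theorem isProbabilityMeasure_betLaw {w : ℝ} (h0 : 0 ≤ w) (h1 : w ≤ 1) :
    IsProbabilityMeasure (betLaw w) := by
  constructor
  simp only [betLaw, Measure.coe_add, Measure.coe_smul, Pi.add_apply, Pi.smul_apply,
    measure_univ, smul_eq_mul, mul_one]
  rw [← ENNReal.ofReal_add h0 (by linarith)]
  simp

/-- The law of an infinite sequence of independent bets. -/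
noncomputable def law (w : ℝ) : Measure (ℕ → Bool) :=
  Measure.infinitePi fun _ => betLaw w

/-- The probability of eventually reaching the goal `1` under bold play from the fortune `f`.
For `f < 0` it is `0`, see `Q_of_neg`. -/
noncomputable def Q (ℓ w f : ℝ) : ℝ :=
  (law w).real {ω | ∃ k, fortune ℓ f ω k = 1}

/-- The fortunes from which bold play reaches exactly `1 - ℓ` with positive probability. -/
def S (ℓ w : ℝ) : Set ℝ :=
  {f | f ∈ Set.Icc (0 : ℝ) 1 ∧ 0 < law w {ω | ∃ k, fortune ℓ f ω k = 1 - ℓ}}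

theorem fortune_nonpos {ℓ f : ℝ} (hℓ : 0 < ℓ) (hf : f ≤ 0) (ω : ℕ → Bool) (k : ℕ) :
    fortune ℓ f ω k ≤ 0 := by
  induction k with
  | zero => exact hf
  | succ k ih =>
    have h : stake ℓ (fortune ℓ f ω k) = fortune ℓ f ω k := by
      unfold stake
      rw [min_eq_left (a := fortune ℓ f ω k) (by linarith), min_eq_right (by linarith)]
    rw [fortune, h]
    split_ifs <;> linarith

theorem Q_of_neg {ℓ w f : ℝ} (hℓ : 0 < ℓ) (hf : f < 0) : Q ℓ w f = 0 := by
  have h : {ω | ∃ k, fortune ℓ f ω k = 1} = ∅ := by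
    ext ω
    simp only [Set.mem_ofPred_eq, Set.mem_empty_iff_false, iff_false, not_exists]
    intro k hk
    have := fortune_nonpos hℓ hf.le ω k
    linarith
  simp [Q, h]

end BoldPlay

namespace BoldPlay

/-! Conditioning on the first bet gives `Q f = w Q (2f)` for `f ≤ ℓ`, `Q f = w Q (f + ℓ) + (1 - w) Q
(f - ℓ)` for `ℓ ≤ f ≤ 1 - ℓ`, and `Q f = w + (1 - w) Q (2f - 1)` for `f ≥ 1 - ℓ`. The gauge `g ε =
(1 - w) ^ (-log₂ ε)` satisfies `(1 - w) g (2ε) = g ε`. Measured against `g`, an increment of `Q`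
over a window inside one region is therefore unchanged at the top, multiplied by `w / (1 - w) < 1`
at the bottom, and averaged in the middle.

Lower bound: `1 - Q (1 - ε)` is at least a multiple of `g ε`. A win at `1 - ℓ` lands on `1`, so `Q`
has increments of order `g` below `1 - ℓ`; a path from `f` to `1 - ℓ` carries this bound back to
`f`, losing a positive factor at each bet (`incrementsGe_of_mem_S`).

Upper bound: the increments are at most `K g` uniformly (`exists_sub_le_gauge`). Off `S` no path
meets `1 - ℓ`, so from a fortune in `[0, 1)` none lands on `1` from the middle region. Losing bets
lead in boundedly many steps from the middle to the bottom, where the contraction is strict. Each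
such pass improves the constant by a fixed factor below `1` (`EventuallyLe.improve`), and iteration
brings it below any `C > 0`.

Irrational limits: let `N` be the integer part of `1 / ℓ` and `y = 1 - (N - 1) ℓ`, which leads to `1
- ℓ` by wins. For large `n` take `f = y / 2 ^ n + (N - 1) ℓ`. Then `f - ℓ` descends to `y / 2 ^ n`
by losses and doubles up to `y`, whereas `f + ℓ = y / 2 ^ n + N ℓ` has an `ℓ`-coordinate too large
for `S` (`coordinates_of_mem_S`). -/

variable {ℓ w : ℝ}

/-! ### One bet -/

/-- The fortune after one bet from the fortune `f`, won if `b = true`. -/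
noncomputable def step (ℓ : ℝ) (b : Bool) (f : ℝ) : ℝ :=
  if b = true then f + stake ℓ f else f - stake ℓ f

/-- The sequence of bets that starts with `b` and goes on as `ω`. -/
def cons (b : Bool) (ω : ℕ → Bool) : ℕ → Bool
  | 0 => b
  | n + 1 => ω n

theorem fortune_succ_eq_step (f : ℝ) (ω : ℕ → Bool) (k : ℕ) :
    fortune ℓ f ω (k + 1) = step ℓ (ω k) (fortune ℓ f ω k) := rfl

theorem fortune_succ (f : ℝ) (ω : ℕ → Bool) (k : ℕ) :
    fortune ℓ f ω (k + 1) = fortune ℓ (step ℓ (ω 0) f) (fun n => ω (n + 1)) k := by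
  induction k with
  | zero => rfl
  | succ k ih => rw [fortune_succ_eq_step, ih]; rfl

theorem fortune_cons_succ (f : ℝ) (b : Bool) (ω : ℕ → Bool) (k : ℕ) :
    fortune ℓ f (cons b ω) (k + 1) = fortune ℓ (step ℓ b f) ω k :=
  fortune_succ f (cons b ω) k

theorem stake_of_le (hℓ1 : ℓ < 1 / 2) {f : ℝ} (hf : f ≤ ℓ) : stake ℓ f = f := by
  unfold stake
  rw [min_eq_left (a := f) (by linarith), min_eq_right hf]

theorem stake_of_mem {f : ℝ} (h1 : ℓ ≤ f) (h2 : f ≤ 1 - ℓ) : stake ℓ f = ℓ :=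
  min_eq_left (le_min h1 (by linarith))

theorem stake_of_ge (hℓ1 : ℓ < 1 / 2) {f : ℝ} (hf : 1 - ℓ ≤ f) : stake ℓ f = 1 - f := by
  unfold stake
  rw [min_eq_right (a := f) (by linarith), min_eq_right (by linarith)]

theorem step_true (f : ℝ) : step ℓ true f = f + stake ℓ f := by simp [step]

theorem step_false (f : ℝ) : step ℓ false f = f - stake ℓ f := by simp [step]

/-- The stake is piecewise linear with slopes `1`, `0`, `-1`, so adding or subtracting it leaves
slopes between `0` and `2`. Two gamblers facing the same bets hence keep their order, which makes
`Q` monotone up to `1`. -/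
theorem step_mono (hℓ1 : ℓ < 1 / 2) (b : Bool) : Monotone (step ℓ b) := by
  intro f g hfg
  cases b
  · rw [step_false, step_false]
    unfold stake
    rcases min_cases ℓ (min f (1 - f)) with h | h <;> rcases min_cases f (1 - f) with h' | h' <;>
      rcases min_cases ℓ (min g (1 - g)) with k | k <;> rcases min_cases g (1 - g) with k' | k' <;>
      linarith
  · rw [step_true, step_true]
    unfold stake
    rcases min_cases ℓ (min f (1 - f)) with h | h <;> rcases min_cases f (1 - f) with h' | h' <;>
      rcases min_cases ℓ (min g (1 - g)) with k | k <;> rcases min_cases g (1 - g) with k' | k' <;>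
      linarith

theorem step_one (hℓ0 : 0 < ℓ) (b : Bool) : step ℓ b 1 = 1 := by
  have : stake ℓ 1 = 0 := by unfold stake; norm_num; exact hℓ0.le
  cases b <;> simp [step, this]

theorem step_zero (hℓ0 : 0 < ℓ) (b : Bool) : step ℓ b 0 = 0 := by
  have : stake ℓ 0 = 0 := by unfold stake; norm_num; exact hℓ0.le
  cases b <;> simp [step, this]

theorem step_mem_Icc (hℓ0 : 0 < ℓ) (hℓ1 : ℓ < 1 / 2) (b : Bool) {f : ℝ}
    (hf : f ∈ Set.Icc (0 : ℝ) 1) : step ℓ b f ∈ Set.Icc (0 : ℝ) 1 :=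
  ⟨by simpa [step_zero hℓ0] using step_mono hℓ1 b hf.1,
    by simpa [step_one hℓ0] using step_mono hℓ1 b hf.2⟩

theorem fortune_const {f : ℝ} (hf : ∀ b, step ℓ b f = f) (ω : ℕ → Bool) (k : ℕ) :
    fortune ℓ f ω k = f := by
  induction k with
  | zero => rfl
  | succ k ih => rw [fortune_succ_eq_step, ih, hf]

theorem fortune_mono (hℓ1 : ℓ < 1 / 2) {f g : ℝ} (hfg : f ≤ g) (ω : ℕ → Bool) (k : ℕ) :
    fortune ℓ f ω k ≤ fortune ℓ g ω k := by
  induction k with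
  | zero => exact hfg
  | succ k ih => exact step_mono hℓ1 _ ih

/-! ### The law of the bets -/

theorem measurable_stake : Measurable (stake ℓ) := by
  unfold stake
  fun_prop

theorem measurable_fortune (f : ℝ) (k : ℕ) : Measurable fun ω => fortune ℓ f ω k := by
  induction k with
  | zero => exact measurable_const
  | succ k ih =>
    refine Measurable.ite ?_ (ih.add (measurable_stake.comp ih)) (ih.sub (measurable_stake.comp ih))
    exact measurableSet_eq_fun (measurable_pi_apply k) measurable_const

theorem measurableSet_hit (f c : ℝ) : MeasurableSet {ω | ∃ k, fortune ℓ f ω k = c} := by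
  have : {ω | ∃ k, fortune ℓ f ω k = c} = ⋃ k, {ω | fortune ℓ f ω k = c} := by
    ext; simp
  rw [this]
  exact .iUnion fun k => measurable_fortune f k (measurableSet_singleton c)

theorem measurable_cons (b : Bool) : Measurable (cons b) := by
  refine measurable_pi_lambda _ fun n => ?_
  cases n with
  | zero => exact measurable_const
  | succ n => exact measurable_pi_apply n

theorem isProbabilityMeasure_law (hw0 : 0 ≤ w) (hw1 : w ≤ 1) : IsProbabilityMeasure (law w) := by
  have := isProbabilityMeasure_betLaw hw0 hw1
  unfold law
  infer_instance

/-- The Markov property at the first bet, checked on the boxes that determine a product measure. -/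
theorem law_eq_add_map_cons (hw0 : 0 ≤ w) (hw1 : w ≤ 1) :
    law w = ENNReal.ofReal w • (law w).map (cons true) +
      ENNReal.ofReal (1 - w) • (law w).map (cons false) := by
  have := isProbabilityMeasure_betLaw hw0 hw1
  symm
  refine Measure.eq_infinitePi _ fun s t ht => ?_
  obtain ⟨n, hn⟩ : ∃ n, s ⊆ Finset.range (n + 1) :=
    (s.exists_nat_subset_range).imp fun n h => h.trans (Finset.range_mono n.le_succ)
  classical
  -- The box is padded with `univ` to an initial segment containing index `0`, so that the first
  -- coordinate can be split off.
  let u : ℕ → Set Bool := fun i => if i ∈ s then t i else Set.univ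
  have hset : Set.pi (s : Set ℕ) t = Set.pi (Finset.range (n + 1) : Set ℕ) u := by
    ext ω
    simp only [Set.mem_pi, u]
    refine ⟨fun h i _ => ?_, fun h i hi => ?_⟩
    · split_ifs with his
      exacts [h i his, trivial]
    · simpa [Finset.mem_coe.1 hi] using h i (hn hi)
  have hprod : ∏ i ∈ s, betLaw w (t i) = ∏ i ∈ Finset.range (n + 1), betLaw w (u i) := by
    rw [← Finset.prod_subset hn]
    · exact Finset.prod_congr rfl fun i hi => by simp [u, hi]
    · intro i _ hi
      rw [show u i = Set.univ from if_neg hi, measure_univ]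
  have hu : ∀ i, MeasurableSet (u i) := fun i => MeasurableSet.of_discrete
  have hcons (b : Bool) : (law w).map (cons b) (Set.pi (Finset.range (n + 1) : Set ℕ) u) =
      (Measure.dirac b) (u 0) * ∏ i ∈ Finset.range n, betLaw w (u (i + 1)) := by
    rw [Measure.map_apply (measurable_cons b)
      (MeasurableSet.pi (Finset.countable_toSet _) fun i _ => hu i),
      Measure.dirac_apply' b (hu 0)]
    by_cases hb : b ∈ u 0
    · have : cons b ⁻¹' Set.pi (Finset.range (n + 1) : Set ℕ) u =
          Set.pi (Finset.range n : Set ℕ) fun i => u (i + 1) := by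
        ext ω
        simp only [Set.mem_preimage, Set.mem_pi, Finset.coe_range, Set.mem_Iio]
        refine ⟨fun h i hi => h (i + 1) (by omega), fun h i hi => ?_⟩
        cases i with
        | zero => exact hb
        | succ i => exact h i (by omega)
      rw [this, law, Measure.infinitePi_pi _ fun i _ => hu (i + 1)]
      simp [hb]
    · have : cons b ⁻¹' Set.pi (Finset.range (n + 1) : Set ℕ) u = ∅ := by
        ext ω
        simp only [Set.mem_preimage, Set.mem_pi, Set.mem_empty_iff_false, iff_false]
        exact fun h => hb (h 0 (by simp))
      rw [this]
      simp [hb]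
  rw [hset, hprod, Finset.prod_range_succ', Measure.add_apply, Measure.smul_apply,
    Measure.smul_apply, hcons, hcons]
  simp only [betLaw, Measure.add_apply, Measure.smul_apply, smul_eq_mul]
  ring

theorem law_hit (hw0 : 0 ≤ w) (hw1 : w ≤ 1) {f c : ℝ} (hf : f ≠ c) :
    law w {ω | ∃ k, fortune ℓ f ω k = c} =
      ENNReal.ofReal w * law w {ω | ∃ k, fortune ℓ (step ℓ true f) ω k = c} +
      ENNReal.ofReal (1 - w) * law w {ω | ∃ k, fortune ℓ (step ℓ false f) ω k = c} := by
  have h (b : Bool) : cons b ⁻¹' {ω | ∃ k, fortune ℓ f ω k = c} =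
      {ω | ∃ k, fortune ℓ (step ℓ b f) ω k = c} := by
    ext ω
    simp only [Set.mem_preimage, Set.mem_ofPred_eq]
    refine ⟨fun ⟨k, hk⟩ => ?_, fun ⟨k, hk⟩ => ⟨k + 1, by rw [fortune_cons_succ, hk]⟩⟩
    cases k with
    | zero => exact absurd hk hf
    | succ k => exact ⟨k, by rw [← hk, fortune_cons_succ]⟩
  conv_lhs => rw [law_eq_add_map_cons hw0 hw1]
  rw [Measure.add_apply, Measure.smul_apply, Measure.smul_apply,
    Measure.map_apply (measurable_cons _) (measurableSet_hit _ _),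
    Measure.map_apply (measurable_cons _) (measurableSet_hit _ _), h, h]
  rfl

/-! ### The probability of reaching the goal -/

theorem Q_one (hℓ0 : 0 < ℓ) (hw0 : 0 ≤ w) (hw1 : w ≤ 1) : Q ℓ w 1 = 1 := by
  have := isProbabilityMeasure_law hw0 hw1
  simp [Q, fortune_const (step_one hℓ0)]

theorem Q_of_nonpos (hℓ0 : 0 < ℓ) {f : ℝ} (hf : f ≤ 0) : Q ℓ w f = 0 := by
  have h : {ω | ∃ k, fortune ℓ f ω k = 1} = ∅ := by
    ext ω
    simp only [Set.mem_ofPred_eq, Set.mem_empty_iff_false, iff_false, not_exists]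
    intro k hk
    have := fortune_nonpos hℓ0 hf ω k
    linarith
  simp [Q, h]

theorem Q_nonneg (f : ℝ) : 0 ≤ Q ℓ w f := measureReal_nonneg

theorem Q_le_one (hw0 : 0 ≤ w) (hw1 : w ≤ 1) (f : ℝ) : Q ℓ w f ≤ 1 := by
  have := isProbabilityMeasure_law hw0 hw1
  exact measureReal_le_one

theorem Q_mono (hℓ0 : 0 < ℓ) (hℓ1 : ℓ < 1 / 2) (hw0 : 0 ≤ w) (hw1 : w ≤ 1) {f g : ℝ}
    (hfg : f ≤ g) (hg : g ≤ 1) : Q ℓ w f ≤ Q ℓ w g := by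
  have := isProbabilityMeasure_law hw0 hw1
  refine measureReal_mono ?_
  rintro ω ⟨k, hk⟩
  refine ⟨k, le_antisymm ?_ (hk ▸ fortune_mono hℓ1 hfg ω k)⟩
  exact (fortune_mono hℓ1 hg ω k).trans_eq (fortune_const (step_one hℓ0) ω k)

theorem Q_eq_step (hℓ0 : 0 < ℓ) (hw0 : 0 ≤ w) (hw1 : w ≤ 1) (f : ℝ) :
    Q ℓ w f = w * Q ℓ w (step ℓ true f) + (1 - w) * Q ℓ w (step ℓ false f) := by
  have := isProbabilityMeasure_law hw0 hw1
  rcases eq_or_ne f 1 with rfl | hf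
  · rw [step_one hℓ0, step_one hℓ0]
    ring
  · unfold Q Measure.real
    rw [law_hit hw0 hw1 hf, ENNReal.toReal_add (by finiteness) (by finiteness),
      ENNReal.toReal_mul, ENNReal.toReal_mul, ENNReal.toReal_ofReal hw0,
      ENNReal.toReal_ofReal (by linarith)]

theorem Q_of_le (hℓ0 : 0 < ℓ) (hℓ1 : ℓ < 1 / 2) (hw0 : 0 ≤ w) (hw1 : w ≤ 1) {f : ℝ}
    (hf : f ≤ ℓ) : Q ℓ w f = w * Q ℓ w (2 * f) := by
  rw [Q_eq_step hℓ0 hw0 hw1, step_true, step_false, stake_of_le hℓ1 hf, sub_self,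
    Q_of_nonpos hℓ0 le_rfl, ← two_mul, mul_zero, add_zero]

theorem Q_of_mem (hℓ0 : 0 < ℓ) (hw0 : 0 ≤ w) (hw1 : w ≤ 1) {f : ℝ}
    (h1 : ℓ ≤ f) (h2 : f ≤ 1 - ℓ) :
    Q ℓ w f = w * Q ℓ w (f + ℓ) + (1 - w) * Q ℓ w (f - ℓ) := by
  rw [Q_eq_step hℓ0 hw0 hw1, step_true, step_false, stake_of_mem h1 h2]

theorem Q_of_ge (hℓ0 : 0 < ℓ) (hℓ1 : ℓ < 1 / 2) (hw0 : 0 ≤ w) (hw1 : w ≤ 1) {f : ℝ}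
    (hf : 1 - ℓ ≤ f) : Q ℓ w f = w + (1 - w) * Q ℓ w (2 * f - 1) := by
  rw [Q_eq_step hℓ0 hw0 hw1, step_true, step_false, stake_of_ge hℓ1 hf, add_sub_cancel,
    Q_one hℓ0 hw0 hw1, mul_one, sub_sub_eq_add_sub, ← two_mul]

/-! ### The fortunes that lead to `1 - ℓ` -/

theorem law_hit_pos (hw0 : 0 < w) (hw1 : w < 1) {c : ℝ} (k : ℕ) :
    ∀ (f : ℝ) (ω : ℕ → Bool), fortune ℓ f ω k = c → 0 < law w {ω | ∃ k, fortune ℓ f ω k = c} := by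
  have := isProbabilityMeasure_law hw0.le hw1.le
  have hc : 0 < law w {ω | ∃ k, fortune ℓ c ω k = c} := by
    have : {ω | ∃ k, fortune ℓ c ω k = c} = Set.univ := by
      ext ω
      simpa using ⟨0, rfl⟩
    simp [this]
  induction k with
  | zero =>
    rintro f ω rfl
    exact hc
  | succ k ih =>
    intro f ω h
    rcases eq_or_ne f c with rfl | hf
    · exact hc
    rw [fortune_succ] at h
    rw [law_hit hw0.le hw1.le hf]
    have := ih _ _ h
    cases hb : ω 0
    · rw [hb] at this
      refine lt_of_lt_of_le (ENNReal.mul_pos ?_ this.ne') le_add_self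
      simpa using hw1
    · rw [hb] at this
      refine lt_of_lt_of_le (ENNReal.mul_pos ?_ this.ne') le_self_add
      simpa using hw0

/-- Every finite win-loss pattern has positive probability, so membership in `S` is a question about
deterministic paths. -/
theorem mem_S_iff (hw0 : 0 < w) (hw1 : w < 1) {f : ℝ} :
    f ∈ S ℓ w ↔ f ∈ Set.Icc (0 : ℝ) 1 ∧ ∃ k ω, fortune ℓ f ω k = 1 - ℓ := by
  refine and_congr_right fun _ => ⟨fun h => ?_, fun ⟨k, ω, h⟩ => law_hit_pos hw0 hw1 k f ω h⟩
  obtain ⟨ω, k, h⟩ := nonempty_of_measure_ne_zero h.ne'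
  exact ⟨k, ω, h⟩

theorem one_sub_mem_S (hℓ0 : 0 < ℓ) (hℓ1 : ℓ < 1 / 2) (hw0 : 0 < w) (hw1 : w < 1) :
    1 - ℓ ∈ S ℓ w :=
  (mem_S_iff hw0 hw1).2 ⟨⟨by linarith, by linarith⟩, 0, fun _ => true, rfl⟩

theorem mem_S_of_step (hw0 : 0 < w) (hw1 : w < 1) {f : ℝ} (hf : f ∈ Set.Icc (0 : ℝ) 1)
    {b : Bool} (h : step ℓ b f ∈ S ℓ w) : f ∈ S ℓ w := by
  obtain ⟨-, k, ω, h⟩ := (mem_S_iff hw0 hw1).1 h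
  exact (mem_S_iff hw0 hw1).2 ⟨hf, k + 1, cons b ω, by rw [fortune_cons_succ, h]⟩

theorem S_induction (hℓ0 : 0 < ℓ) (hℓ1 : ℓ < 1 / 2) (hw0 : 0 < w) (hw1 : w < 1) {P : ℝ → Prop}
    (base : P (1 - ℓ))
    (ind : ∀ f ∈ S ℓ w, ∀ b, step ℓ b f ∈ S ℓ w → P (step ℓ b f) → P f) {f : ℝ}
    (hf : f ∈ S ℓ w) : P f := by
  obtain ⟨hf', k, ω, h⟩ := (mem_S_iff hw0 hw1).1 hf
  clear hf
  induction k generalizing f ω with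
  | zero =>
    have : f = 1 - ℓ := h
    rwa [this]
  | succ k ih =>
    have h' := h
    rw [fortune_succ] at h
    have hs := step_mem_Icc hℓ0 hℓ1 (ω 0) hf'
    exact ind f ((mem_S_iff hw0 hw1).2 ⟨hf', k + 1, ω, h'⟩) (ω 0)
      ((mem_S_iff hw0 hw1).2 ⟨hs, k, _, h⟩) (ih hs _ h)

theorem zero_notMem_S (hℓ0 : 0 < ℓ) (hℓ1 : ℓ < 1 / 2) (hw0 : 0 < w) (hw1 : w < 1) :
    (0 : ℝ) ∉ S ℓ w := fun h => by
  obtain ⟨-, k, ω, h⟩ := (mem_S_iff hw0 hw1).1 h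
  rw [fortune_const (step_zero hℓ0)] at h
  linarith

theorem one_notMem_S (hℓ0 : 0 < ℓ) (hw0 : 0 < w) (hw1 : w < 1) : (1 : ℝ) ∉ S ℓ w := fun h => by
  obtain ⟨-, k, ω, h⟩ := (mem_S_iff hw0 hw1).1 h
  rw [fortune_const (step_one hℓ0)] at h
  linarith

theorem mem_S_of_two_mul (hℓ1 : ℓ < 1 / 2) (hw0 : 0 < w) (hw1 : w < 1) {f : ℝ} (hf : f ≤ ℓ)
    (h : 2 * f ∈ S ℓ w) : f ∈ S ℓ w := by
  refine mem_S_of_step hw0 hw1 ⟨by linarith [h.1.1], by linarith [h.1.1]⟩ (b := true) ?_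
  rwa [step_true, stake_of_le hℓ1 hf, ← two_mul]

theorem mem_S_of_two_mul_sub_one (hℓ1 : ℓ < 1 / 2) (hw0 : 0 < w) (hw1 : w < 1) {f : ℝ}
    (hf : 1 - ℓ ≤ f) (h : 2 * f - 1 ∈ S ℓ w) : f ∈ S ℓ w := by
  refine mem_S_of_step hw0 hw1 ⟨by linarith [h.1.1], by linarith [h.1.2]⟩ (b := false) ?_
  rwa [step_false, stake_of_ge hℓ1 hf, sub_sub_eq_add_sub, ← two_mul]

theorem mem_S_of_add (hℓ0 : 0 < ℓ) (hw0 : 0 < w) (hw1 : w < 1) {f : ℝ} (h1 : ℓ ≤ f)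
    (h2 : f ≤ 1 - ℓ) (h : f + ℓ ∈ S ℓ w) : f ∈ S ℓ w := by
  refine mem_S_of_step hw0 hw1 ⟨by linarith, by linarith⟩ (b := true) ?_
  rwa [step_true, stake_of_mem h1 h2]

theorem mem_S_of_sub (hℓ0 : 0 < ℓ) (hw0 : 0 < w) (hw1 : w < 1) {f : ℝ} (h1 : ℓ ≤ f)
    (h2 : f ≤ 1 - ℓ) (h : f - ℓ ∈ S ℓ w) : f ∈ S ℓ w := by
  refine mem_S_of_step hw0 hw1 ⟨by linarith, by linarith⟩ (b := false) ?_
  rwa [step_false, stake_of_mem h1 h2]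

/-- Induction along the bets of a path that leads to `1 - ℓ`. -/
theorem S_induction_cases (hℓ0 : 0 < ℓ) (hℓ1 : ℓ < 1 / 2) (hw0 : 0 < w) (hw1 : w < 1)
    {P : ℝ → Prop} (base : P (1 - ℓ))
    (low : ∀ f, 0 < f → f ≤ ℓ → P (2 * f) → P f)
    (up : ∀ f, ℓ < f → f < 1 - ℓ → P (f + ℓ) → P f)
    (down : ∀ f, ℓ < f → f < 1 - ℓ → P (f - ℓ) → P f)
    (top : ∀ f, 1 - ℓ < f → f < 1 → P (2 * f - 1) → P f) {f : ℝ} (hf : f ∈ S ℓ w) : P f := by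
  refine S_induction hℓ0 hℓ1 hw0 hw1 base (fun f hf b hS hP => ?_) hf
  have hf0 : 0 < f := hf.1.1.lt_of_ne fun h => zero_notMem_S hℓ0 hℓ1 hw0 hw1 (h ▸ hf)
  have hf1 : f < 1 := hf.1.2.lt_of_ne fun h => one_notMem_S hℓ0 hw0 hw1 (h ▸ hf)
  rcases le_or_gt f ℓ with h1 | h1
  · cases b
    · rw [step_false, stake_of_le hℓ1 h1, sub_self] at hS
      exact absurd hS (zero_notMem_S hℓ0 hℓ1 hw0 hw1)
    · rw [step_true, stake_of_le hℓ1 h1, ← two_mul] at hP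
      exact low f hf0 h1 hP
  rcases lt_trichotomy f (1 - ℓ) with h2 | rfl | h2
  · cases b
    · rw [step_false, stake_of_mem h1.le h2.le] at hP
      exact down f h1 h2 hP
    · rw [step_true, stake_of_mem h1.le h2.le] at hP
      exact up f h1 h2 hP
  · exact base
  · cases b
    · rw [step_false, stake_of_ge hℓ1 h2.le, sub_sub_eq_add_sub, ← two_mul] at hP
      exact top f h2 hf1 hP
    · rw [step_true, stake_of_ge hℓ1 h2.le, add_sub_cancel] at hS
      exact absurd hS (one_notMem_S hℓ0 hw0 hw1)

/-! ### The gauge -/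

/-- The gauge `(1 - w) ^ (-log₂ ε)`. -/
noncomputable def gauge (w ε : ℝ) : ℝ := (1 - w) ^ (-Real.logb 2 ε)

theorem gauge_pos (hw1 : w < 1) (ε : ℝ) : 0 < gauge w ε :=
  Real.rpow_pos_of_pos (by linarith) _

/-- The factor `1 - w` is that of a losing bet from above `1 - ℓ`, which doubles distances: such
bets leave increments relative to the gauge unchanged. -/
theorem mul_gauge_two_mul (hw1 : w < 1) {ε : ℝ} (hε : 0 < ε) :
    (1 - w) * gauge w (2 * ε) = gauge w ε := by
  have h : 0 < 1 - w := by linarith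
  have hl : Real.logb 2 (2 * ε) = 1 + Real.logb 2 ε := by
    rw [Real.logb_mul two_ne_zero hε.ne', Real.logb_self_eq_one one_lt_two]
  unfold gauge
  rw [hl]
  nth_rewrite 1 [← Real.rpow_one (1 - w)]
  rw [← Real.rpow_add h]
  congr 1
  ring

theorem gauge_mono (hw0 : 0 ≤ w) (hw1 : w < 1) {ε η : ℝ} (hε : 0 < ε) (h : ε ≤ η) :
    gauge w ε ≤ gauge w η :=
  Real.rpow_le_rpow_of_exponent_ge (by linarith) (by linarith)
    (neg_le_neg (Real.logb_le_logb_of_le one_lt_two hε h))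

theorem doubling_induction {a : ℝ} {P : ℝ → Prop} (base : ∀ ε, a ≤ ε → P ε)
    (ind : ∀ ε, 0 < ε → ε < a → P (2 * ε) → P ε) {ε : ℝ} (hε : 0 < ε) : P ε := by
  have key (n : ℕ) : ∀ ε, 0 < ε → a ≤ 2 ^ n * ε → P ε := by
    induction n with
    | zero => exact fun ε _ h => base ε (by simpa using h)
    | succ n ih =>
      intro ε hε h
      rcases le_or_gt a ε with h' | h'
      · exact base ε h'
      · exact ind ε hε h' (ih _ (by linarith) (by rw [pow_succ] at h; linarith))
  obtain ⟨n, hn⟩ := pow_unbounded_of_one_lt (a / ε) one_lt_two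
  exact key n ε hε ((div_lt_iff₀ hε).1 hn).le

/-! ### Bounds at the ends -/

theorem one_le_gauge_div (hw0 : 0 ≤ w) (hw1 : w < 1) {a ε : ℝ} (ha : 0 < a) (h : a ≤ ε) :
    1 ≤ (gauge w a)⁻¹ * gauge w ε := by
  rw [inv_mul_eq_div, one_le_div (gauge_pos hw1 a)]
  exact gauge_mono hw0 hw1 ha h

theorem Q_le_gauge (hℓ0 : 0 < ℓ) (hℓ1 : ℓ < 1 / 2) (hw0 : 0 < w) (hw1 : w < 1 / 2) {ε : ℝ}
    (hε : 0 < ε) : Q ℓ w ε ≤ (gauge w ℓ)⁻¹ * gauge w ε := by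
  have hw1' : w < 1 := by linarith
  refine doubling_induction (a := ℓ) (P := fun ε => Q ℓ w ε ≤ (gauge w ℓ)⁻¹ * gauge w ε)
    (fun ε h => ?_) (fun ε h0 h ih => ?_) hε
  · exact (Q_le_one hw0.le hw1'.le ε).trans (one_le_gauge_div hw0.le hw1' hℓ0 h)
  · rw [Q_of_le hℓ0 hℓ1 hw0.le hw1'.le h.le, ← mul_gauge_two_mul hw1' h0]
    have := Q_nonneg (ℓ := ℓ) (w := w) (2 * ε)
    nlinarith

theorem one_sub_Q_le_gauge (hℓ0 : 0 < ℓ) (hℓ1 : ℓ < 1 / 2) (hw0 : 0 < w) (hw1 : w < 1 / 2) {ε : ℝ}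
    (hε : 0 < ε) : 1 - Q ℓ w (1 - ε) ≤ (gauge w ℓ)⁻¹ * gauge w ε := by
  have hw1' : w < 1 := by linarith
  refine doubling_induction (a := ℓ) (P := fun ε => 1 - Q ℓ w (1 - ε) ≤ (gauge w ℓ)⁻¹ * gauge w ε)
    (fun ε h => ?_) (fun ε h0 h ih => ?_) hε
  · have := one_le_gauge_div hw0.le hw1' hℓ0 h
    linarith [Q_nonneg (ℓ := ℓ) (w := w) (1 - ε)]
  · rw [Q_of_ge hℓ0 hℓ1 hw0.le hw1'.le (f := 1 - ε) (by linarith), ← mul_gauge_two_mul hw1' h0,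
      show 2 * (1 - ε) - 1 = 1 - 2 * ε by ring]
    nlinarith

/-- Successive losses lead to a fortune of at most `ℓ`, where `Q f = w Q (2f) ≤ w`. -/
theorem Q_lt_one (hℓ0 : 0 < ℓ) (hℓ1 : ℓ < 1 / 2) (hw0 : 0 < w) (hw1 : w < 1) {f : ℝ}
    (hf : f ≤ 1 - ℓ) : Q ℓ w f < 1 := by
  have key (n : ℕ) : ∀ f, f ≤ 1 - ℓ → f ≤ (n + 1) * ℓ → Q ℓ w f < 1 := by
    have low (f : ℝ) (h : f ≤ ℓ) : Q ℓ w f < 1 := by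
      rw [Q_of_le hℓ0 hℓ1 hw0.le hw1.le h]
      nlinarith [Q_le_one (ℓ := ℓ) hw0.le hw1.le (2 * f)]
    induction n with
    | zero => exact fun f _ h => low f (by simpa using h)
    | succ n ih =>
      intro f h1 h
      rcases le_or_gt f ℓ with h' | h'
      · exact low f h'
      rw [Q_of_mem hℓ0 hw0.le hw1.le h'.le h1]
      have := ih (f - ℓ) (by linarith) (by push_cast at h; linarith)
      nlinarith [Q_le_one (ℓ := ℓ) hw0.le hw1.le (f + ℓ)]
  obtain ⟨n, hn⟩ := exists_nat_gt (f / ℓ)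
  rw [div_lt_iff₀ hℓ0] at hn
  exact key n f hf (by linarith)

theorem exists_gauge_le_one_sub_Q (hℓ0 : 0 < ℓ) (hℓ1 : ℓ < 1 / 2) (hw0 : 0 < w)
    (hw1 : w < 1) :
    ∃ C, 0 < C ∧ ∀ ε, 0 < ε → ε < ℓ → C * gauge w ε ≤ 1 - Q ℓ w (1 - ε) := by
  have h1 := Q_lt_one hℓ0 hℓ1 hw0 hw1 le_rfl
  have hg := gauge_pos hw1 (2 * ℓ)
  refine ⟨(1 - Q ℓ w (1 - ℓ)) / gauge w (2 * ℓ), by apply div_pos <;> linarith, ?_⟩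
  intro ε hε hεℓ
  have hC : 0 < (1 - Q ℓ w (1 - ℓ)) / gauge w (2 * ℓ) := by apply div_pos <;> linarith
  -- Doubling a scale below `ℓ` stays below `2 * ℓ`, so the base case only concerns scales in `[ℓ,
  -- 2ℓ]`, where the gauge is at most `gauge w (2 * ℓ)`.
  refine doubling_induction (a := ℓ) (P := fun ε => ε ≤ 2 * ℓ →
    (1 - Q ℓ w (1 - ℓ)) / gauge w (2 * ℓ) * gauge w ε ≤ 1 - Q ℓ w (1 - ε))
    (fun ε h h' => ?_) (fun ε h0 h ih _ => ?_) hε (by linarith)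
  · have hm := gauge_mono hw0.le hw1 (hℓ0.trans_le h) h'
    have hQ := Q_mono hℓ0 hℓ1 hw0.le hw1.le (f := 1 - ε) (g := 1 - ℓ) (by linarith) (by linarith)
    calc _ ≤ (1 - Q ℓ w (1 - ℓ)) / gauge w (2 * ℓ) * gauge w (2 * ℓ) := by gcongr
      _ = 1 - Q ℓ w (1 - ℓ) := div_mul_cancel₀ _ hg.ne'
      _ ≤ _ := by linarith
  · have := ih (by linarith)
    rw [Q_of_ge hℓ0 hℓ1 hw0.le hw1.le (f := 1 - ε) (by linarith), ← mul_gauge_two_mul hw1 h0,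
      show 2 * (1 - ε) - 1 = 1 - 2 * ε by ring]
    nlinarith

/-! ### Increments -/

theorem sub_of_le (hℓ0 : 0 < ℓ) (hℓ1 : ℓ < 1 / 2) (hw0 : 0 < w) (hw1 : w < 1) {f ε : ℝ}
    (hε : 0 < ε) (hf : f ≤ ℓ) :
    Q ℓ w f - Q ℓ w (f - ε) = w * (Q ℓ w (2 * f) - Q ℓ w (2 * f - 2 * ε)) := by
  rw [Q_of_le hℓ0 hℓ1 hw0.le hw1.le hf,
    Q_of_le hℓ0 hℓ1 hw0.le hw1.le (f := f - ε) (by linarith), mul_sub 2]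
  ring

theorem sub_of_mem (hℓ0 : 0 < ℓ) (hw0 : 0 < w) (hw1 : w < 1) {f ε : ℝ}
    (hε : 0 < ε) (h1 : ℓ ≤ f - ε) (h2 : f ≤ 1 - ℓ) :
    Q ℓ w f - Q ℓ w (f - ε) = w * (Q ℓ w (f + ℓ) - Q ℓ w (f + ℓ - ε)) +
      (1 - w) * (Q ℓ w (f - ℓ) - Q ℓ w (f - ℓ - ε)) := by
  rw [Q_of_mem hℓ0 hw0.le hw1.le (f := f) (by linarith) h2,
    Q_of_mem hℓ0 hw0.le hw1.le h1 (by linarith), sub_add_eq_add_sub, sub_right_comm]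
  ring

theorem sub_of_ge (hℓ0 : 0 < ℓ) (hℓ1 : ℓ < 1 / 2) (hw0 : 0 < w) (hw1 : w < 1) {f ε : ℝ}
    (hε : 0 < ε) (hf : 1 - ℓ ≤ f - ε) :
    Q ℓ w f - Q ℓ w (f - ε) = (1 - w) * (Q ℓ w (2 * f - 1) - Q ℓ w (2 * f - 1 - 2 * ε)) := by
  rw [Q_of_ge hℓ0 hℓ1 hw0.le hw1.le (f := f) (by linarith),
    Q_of_ge hℓ0 hℓ1 hw0.le hw1.le hf, show 2 * (f - ε) - 1 = 2 * f - 1 - 2 * ε by ring]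
  ring

theorem sub_le_one (hw0 : 0 < w) (hw1 : w < 1) (f g : ℝ) : Q ℓ w f - Q ℓ w g ≤ 1 := by
  linarith [Q_le_one (ℓ := ℓ) hw0.le hw1.le f, Q_nonneg (ℓ := ℓ) (w := w) g]

/-- The increments of `Q` below `f` are at least a multiple of the gauge. -/
def IncrementsGe (ℓ w f : ℝ) : Prop :=
  ∃ C δ : ℝ, 0 < C ∧ 0 < δ ∧ ∀ ε, 0 < ε → ε < δ → C * gauge w ε ≤ Q ℓ w f - Q ℓ w (f - ε)

theorem incrementsGe_of_mem_S (hℓ0 : 0 < ℓ) (hℓ1 : ℓ < 1 / 2) (hw0 : 0 < w) (hw1 : w < 1)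
    {f : ℝ} (hf : f ∈ S ℓ w) : IncrementsGe ℓ w f := by
  have hq : 0 < 1 - w := by linarith
  have mono {f g : ℝ} (hfg : f ≤ g) (hg : g ≤ 1) := Q_mono hℓ0 hℓ1 hw0.le hw1.le hfg hg
  refine S_induction_cases hℓ0 hℓ1 hw0 hw1 ?_ (fun f h0 h1 ih => ?_) (fun f h1 h2 ih => ?_)
    (fun f h1 h2 ih => ?_) (fun f h1 h2 ih => ?_) hf
  · obtain ⟨C, hC, h⟩ := exists_gauge_le_one_sub_Q hℓ0 hℓ1 hw0 hw1
    -- The bound `1 - 2 * ℓ` keeps `1 - ℓ - ε` at or above `ℓ`, so that both ends of the window obey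
    -- the middle equation.
    refine ⟨w * C, min ℓ (1 - 2 * ℓ), by positivity, lt_min hℓ0 (by linarith), fun ε hε hεδ => ?_⟩
    rw [lt_min_iff] at hεδ
    rw [sub_of_mem hℓ0 hw0 hw1 hε (by linarith) le_rfl, sub_add_cancel, Q_one hℓ0 hw0.le hw1.le]
    have h1 := h ε hε hεδ.1
    have h2 := mono (f := 1 - ℓ - ℓ - ε) (g := 1 - ℓ - ℓ) (by linarith) (by linarith)
    nlinarith
  · obtain ⟨C, δ, hC, hδ, h⟩ := ih
    refine ⟨w * C, δ / 2, by positivity, by positivity, fun ε hε hεδ => ?_⟩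
    rw [sub_of_le hℓ0 hℓ1 hw0 hw1 hε h1, mul_assoc]
    refine mul_le_mul_of_nonneg_left (le_trans ?_ (h (2 * ε) (by linarith) (by linarith))) hw0.le
    gcongr
    exact gauge_mono hw0.le hw1 hε (by linarith)
  · obtain ⟨C, δ, hC, hδ, h⟩ := ih
    refine ⟨w * C, min δ (f - ℓ), by positivity, lt_min hδ (by linarith), fun ε hε hεδ => ?_⟩
    rw [lt_min_iff] at hεδ
    rw [sub_of_mem hℓ0 hw0 hw1 hε (by linarith) h2.le]
    have h3 := h ε hε hεδ.1
    have h4 := mono (f := f - ℓ - ε) (g := f - ℓ) (by linarith) (by linarith)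
    nlinarith
  · obtain ⟨C, δ, hC, hδ, h⟩ := ih
    refine ⟨(1 - w) * C, min δ (f - ℓ), by positivity, lt_min hδ (by linarith),
      fun ε hε hεδ => ?_⟩
    rw [lt_min_iff] at hεδ
    rw [sub_of_mem hℓ0 hw0 hw1 hε (by linarith) h2.le]
    have h3 := h ε hε hεδ.1
    have h4 := mono (f := f + ℓ - ε) (g := f + ℓ) (by linarith) (by linarith)
    nlinarith
  · obtain ⟨C, δ, hC, hδ, h⟩ := ih
    refine ⟨C, min (δ / 2) (f - (1 - ℓ)), hC, lt_min (by positivity) (by linarith),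
      fun ε hε hεδ => ?_⟩
    rw [lt_min_iff] at hεδ
    rw [sub_of_ge hℓ0 hℓ1 hw0 hw1 hε (by linarith), ← mul_gauge_two_mul hw1 hε]
    have h3 := h (2 * ε) (by linarith) (by linarith)
    nlinarith

theorem exists_gauge_le_sub (hℓ0 : 0 < ℓ) (hℓ1 : ℓ < 1 / 2) (hw0 : 0 < w) (hw1 : w < 1)
    {f : ℝ} (hf : f ∈ S ℓ w) :
    ∃ C, 0 < C ∧ ∀ ε, 0 < ε → ε < ℓ → C * gauge w ε ≤ Q ℓ w f - Q ℓ w (f - ε) := by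
  obtain ⟨C, δ, hC, hδ, h⟩ := incrementsGe_of_mem_S hℓ0 hℓ1 hw0 hw1 hf
  have hgℓ := gauge_pos hw1 ℓ
  have hgδ := gauge_pos hw1 (δ / 2)
  -- For `δ ≤ ε < ℓ` the increment is at least the one at scale `δ / 2`, while the gauge is at most
  -- `gauge w ℓ`.
  refine ⟨min C (C * gauge w (δ / 2) / gauge w ℓ), lt_min hC (by positivity), fun ε hε hεℓ => ?_⟩
  have hg := gauge_pos hw1 ε
  rcases lt_or_ge ε δ with h1 | h1
  · exact (mul_le_mul_of_nonneg_right (min_le_left _ _) hg.le).trans (h ε hε h1)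
  · calc _ ≤ C * gauge w (δ / 2) / gauge w ℓ * gauge w ℓ := by
          gcongr
          · exact min_le_right _ _
          · exact gauge_mono hw0.le hw1 hε hεℓ.le
      _ = C * gauge w (δ / 2) := div_mul_cancel₀ _ hgℓ.ne'
      _ ≤ Q ℓ w f - Q ℓ w (f - δ / 2) := h _ (by linarith) (by linarith)
      _ ≤ _ := sub_le_sub_left
        (Q_mono hℓ0 hℓ1 hw0.le hw1.le (by linarith) (by linarith [hf.1.2])) _

/-! ### The uniform upper bound -/

/-- The weight `1 - (1 - w / (1 - w)) (1 - w) ^ j`: the increments of `Q` below a fortune of at most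
`(j + 1) ℓ`, relative to the gauge, shrink at least by this factor within `j + 1` bets. -/
noncomputable def levelWeight (w : ℝ) (j : ℕ) : ℝ := 1 - (1 - w / (1 - w)) * (1 - w) ^ j

theorem levelWeight_zero : levelWeight w 0 = w / (1 - w) := by simp [levelWeight]

theorem levelWeight_succ (j : ℕ) :
    levelWeight w (j + 1) = w + (1 - w) * levelWeight w j := by
  unfold levelWeight
  ring

theorem levelWeight_lt_one (hw1 : w < 1 / 2) (j : ℕ) : levelWeight w j < 1 := by
  have h : w / (1 - w) < 1 := by rw [div_lt_one] <;> linarith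
  have := pow_pos (show 0 < 1 - w by linarith) j
  unfold levelWeight
  nlinarith

theorem levelWeight_pos (hw0 : 0 < w) (hw1 : w < 1 / 2) (j : ℕ) : 0 < levelWeight w j := by
  have h1 : 0 < 1 - w := by linarith
  induction j with
  | zero => rw [levelWeight_zero]; positivity
  | succ j ih => rw [levelWeight_succ]; positivity

theorem le_levelWeight (hw0 : 0 < w) (hw1 : w < 1 / 2) (j : ℕ) : w / (1 - w) ≤ levelWeight w j := by
  induction j with
  | zero => rw [levelWeight_zero]
  | succ j ih =>
    have := levelWeight_lt_one hw1 j
    rw [levelWeight_succ]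
    nlinarith

theorem mul_gauge_two_mul_eq_div (hw1 : w < 1) {ε : ℝ} (hε : 0 < ε) :
    w * gauge w (2 * ε) = w / (1 - w) * gauge w ε := by
  rw [← mul_gauge_two_mul hw1 hε, div_mul_eq_mul_div, mul_left_comm,
    mul_div_cancel_left₀ _ (show 1 - w ≠ 0 by linarith)]

/-- On scales of at least `δ` the increments of `Q` are at most `H` times the gauge. -/
def IncrementsLe (ℓ w δ H : ℝ) : Prop :=
  ∀ f ≤ 1, ∀ ε, δ ≤ ε → Q ℓ w f - Q ℓ w (f - ε) ≤ H * gauge w ε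

/-- For a window straddling `ℓ`, the winning branches differ by at most an increment of `Q` at scale
`2ε`, because `f + ℓ - 2ε ≤ 2 (f - ε)`. The losing branch from `f` reaches `f - ℓ < ε`, and `Q` is
there at most a multiple of the gauge. -/
theorem IncrementsLe.of_sub_lt (hℓ0 : 0 < ℓ) (hℓ1 : ℓ < 1 / 2) (hw0 : 0 < w)
    (hw1 : w < 1 / 2) {δ H : ℝ} (hδ : 0 < δ) (h : IncrementsLe ℓ w δ H)
    {f : ℝ} (hf : f ≤ 1 - ℓ) {ε : ℝ} (hε : δ ≤ ε) (hfε : f ≤ ℓ ∨ f - ε < ℓ) :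
    Q ℓ w f - Q ℓ w (f - ε) ≤ (w / (1 - w) * H + (gauge w ℓ)⁻¹) * gauge w ε := by
  have hw1' : w < 1 := by linarith
  have hg := gauge_pos hw1' ε
  have hgℓ := gauge_pos hw1' ℓ
  have hε0 : 0 < ε := hδ.trans_le hε
  have double (g : ℝ) (hg1 : g ≤ 1) :
      w * (Q ℓ w g - Q ℓ w (g - 2 * ε)) ≤ w / (1 - w) * H * gauge w ε :=
    calc _ ≤ w * (H * gauge w (2 * ε)) :=
          mul_le_mul_of_nonneg_left (h g hg1 _ (by linarith)) hw0.le
      _ = _ := by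
          rw [mul_left_comm, mul_gauge_two_mul_eq_div hw1' hε0]
          ring
  rw [add_mul]
  rcases le_or_gt f ℓ with hl | hl
  · have : 0 ≤ (gauge w ℓ)⁻¹ * gauge w ε := by positivity
    rw [sub_of_le hℓ0 hℓ1 hw0 hw1' hε0 hl]
    linarith [double (2 * f) (by linarith)]
  have hc := hfε.resolve_left hl.not_ge
  rw [Q_of_mem hℓ0 hw0.le hw1'.le hl.le hf, Q_of_le hℓ0 hℓ1 hw0.le hw1'.le hc.le]
  have h1 := double (f + ℓ) (by linarith)
  have h2 := Q_mono hℓ0 hℓ1 hw0.le hw1'.le (f := f + ℓ - 2 * ε) (g := 2 * (f - ε))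
    (by linarith) (by linarith)
  -- Monotonicity of `Q` is available only up to the fortune `1`, hence the cap on `ε`.
  have h3 := Q_mono hℓ0 hℓ1 hw0.le hw1'.le (f := f - ℓ) (g := min ε 1)
    (le_min (by linarith) (by linarith)) (min_le_right _ _)
  have h4 : Q ℓ w (min ε 1) ≤ (gauge w ℓ)⁻¹ * gauge w ε :=
    (Q_le_gauge hℓ0 hℓ1 hw0 hw1 (lt_min hε0 one_pos)).trans <|
      mul_le_mul_of_nonneg_left (gauge_mono hw0.le hw1' (lt_min hε0 one_pos) (min_le_left _ _))
        (by positivity)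
  have h5 := Q_nonneg (ℓ := ℓ) (w := w) (f - ℓ)
  nlinarith

/-- For a window inside the middle region, a win is bounded by `H` and a loss by level `j`; this is
the recursion `levelWeight_succ`. The additive constant does not accumulate, since it enters with
weight `1 - w` only. -/
theorem IncrementsLe.of_le_one_sub (hℓ0 : 0 < ℓ) (hℓ1 : ℓ < 1 / 2) (hw0 : 0 < w)
    (hw1 : w < 1 / 2) {δ H : ℝ} (hδ : 0 < δ) (hH : 0 ≤ H) (h : IncrementsLe ℓ w δ H) (j : ℕ)
    {ε : ℝ} (hε : δ ≤ ε) :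
    ∀ f ≤ 1 - ℓ, f ≤ (j + 1) * ℓ →
      Q ℓ w f - Q ℓ w (f - ε) ≤ (levelWeight w j * H + (gauge w ℓ)⁻¹) * gauge w ε := by
  have hw1' : w < 1 := by linarith
  have hg := gauge_pos hw1' ε
  have hgℓ := gauge_pos hw1' ℓ
  have hε0 : 0 < ε := hδ.trans_le hε
  induction j with
  | zero =>
    intro f hf hfj
    rw [levelWeight_zero]
    exact h.of_sub_lt hℓ0 hℓ1 hw0 hw1 hδ hf hε (Or.inl (by simpa using hfj))
  | succ j ih =>
    intro f hf hfj
    by_cases hc : f ≤ ℓ ∨ f - ε < ℓ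
    · refine (h.of_sub_lt hℓ0 hℓ1 hw0 hw1 hδ hf hε hc).trans ?_
      gcongr
      exact le_levelWeight hw0 hw1 _
    · rw [not_or, not_le, not_lt] at hc
      push_cast at hfj
      rw [sub_of_mem hℓ0 hw0 hw1' hε0 hc.2 hf, levelWeight_succ]
      have h1 := mul_le_mul_of_nonneg_left (h (f + ℓ) (by linarith) ε hε) hw0.le
      have h2 := mul_le_mul_of_nonneg_left (ih (f - ℓ) (by linarith) (by linarith))
        (show 0 ≤ 1 - w by linarith)
      have h3 : 0 ≤ w * ((gauge w ℓ)⁻¹ * gauge w ε) := by positivity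
      linarith

theorem exists_level (hℓ0 : 0 < ℓ) (a : ℝ) : ∃ j : ℕ, a ≤ (j + 1) * ℓ := by
  obtain ⟨n, hn⟩ := exists_nat_gt (a / ℓ)
  rw [div_lt_iff₀ hℓ0] at hn
  exact ⟨n, by linarith⟩

/-- Windows above `1 - ℓ` are doubled with no change of constant. For a window straddling `1 - ℓ`
with `ε < d`, the condition `d ≤ ℓ / 2` puts `2f - 1` below `1 - ℓ`, and `d ≤ 1 - 2ℓ` keeps `f - ε`
above `ℓ`. Scales of at least `d` are covered by the trivial bound `1`. -/
theorem IncrementsLe.improve (hℓ0 : 0 < ℓ) (hℓ1 : ℓ < 1 / 2) (hw0 : 0 < w) (hw1 : w < 1 / 2)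
    {d : ℝ} (hd0 : 0 < d) (hdℓ : d ≤ ℓ / 2) (hd : d ≤ 1 - 2 * ℓ) {j : ℕ}
    (hj : 1 - ℓ ≤ (j + 1) * ℓ) {δ H : ℝ} (hδ : 0 < δ) (hH : 0 ≤ H) (h : IncrementsLe ℓ w δ H) :
    IncrementsLe ℓ w δ
      (levelWeight w j * H + ((gauge w ℓ)⁻¹ + (gauge w ℓ)⁻¹ + (gauge w d)⁻¹)) := by
  have hw1' : w < 1 := by linarith
  have hq : 0 < 1 - w := by linarith
  have hgℓ := gauge_pos hw1' ℓ
  have hgd := gauge_pos hw1' d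
  have hρ := levelWeight_pos hw0 hw1 j
  have below {ε : ℝ} (hε : δ ≤ ε) (f : ℝ) (hf : f ≤ 1 - ℓ) :=
    h.of_le_one_sub hℓ0 hℓ1 hw0 hw1 hδ hH j hε f hf (hf.trans hj)
  suffices key : ∀ ε, 0 < ε → δ ≤ ε → ∀ f ≤ 1, Q ℓ w f - Q ℓ w (f - ε) ≤
      (levelWeight w j * H + ((gauge w ℓ)⁻¹ + (gauge w ℓ)⁻¹ + (gauge w d)⁻¹)) * gauge w ε from
    fun f hf ε hε => key ε (hδ.trans_le hε) hε f hf
  intro ε hε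
  refine doubling_induction (a := d) (P := fun ε => δ ≤ ε → ∀ f ≤ 1, Q ℓ w f - Q ℓ w (f - ε) ≤
      (levelWeight w j * H + ((gauge w ℓ)⁻¹ + (gauge w ℓ)⁻¹ + (gauge w d)⁻¹)) * gauge w ε)
      (fun ε hdε hδε f hf => ?_) (fun ε hε hεd ih hδε f hf => ?_) hε
  · have hg := gauge_pos hw1' ε
    refine (sub_le_one hw0 hw1' _ _).trans ((one_le_gauge_div hw0.le hw1' hd0 hdε).trans ?_)
    gcongr
    have : 0 ≤ levelWeight w j * H + ((gauge w ℓ)⁻¹ + (gauge w ℓ)⁻¹) := by positivity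
    linarith
  have hg := gauge_pos hw1' ε
  rcases le_or_gt f (1 - ℓ) with h1 | h1
  · refine (below hδε f h1).trans ?_
    gcongr
    have : 0 ≤ (gauge w ℓ)⁻¹ + (gauge w d)⁻¹ := by positivity
    linarith
  rcases le_or_gt (1 - ℓ) (f - ε) with h2 | h2
  · rw [sub_of_ge hℓ0 hℓ1 hw0 hw1' hε h2, ← mul_gauge_two_mul hw1' hε, mul_left_comm]
    exact mul_le_mul_of_nonneg_left (ih (by linarith) _ (by linarith)) hq.le
  · rw [Q_of_ge hℓ0 hℓ1 hw0.le hw1'.le h1.le,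
      Q_of_mem hℓ0 hw0.le hw1'.le (f := f - ε) (by linarith) h2.le]
    have h3 : 1 - Q ℓ w (f - ε + ℓ) ≤ (gauge w ℓ)⁻¹ * gauge w ε := by
      have := one_sub_Q_le_gauge hℓ0 hℓ1 hw0 hw1 (ε := 1 - ℓ - (f - ε)) (by linarith)
      rw [show 1 - (1 - ℓ - (f - ε)) = f - ε + ℓ by ring] at this
      refine this.trans ?_
      gcongr
      exact gauge_mono hw0.le hw1' (by linarith) (by linarith)
    have h4 := mul_le_mul_of_nonneg_left
      (below (ε := 2 * ε) (by linarith) (2 * f - 1) (by linarith)) hq.le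
    rw [mul_left_comm, mul_gauge_two_mul hw1' hε] at h4
    have h5 := Q_mono hℓ0 hℓ1 hw0.le hw1'.le (f := 2 * f - 1 - 2 * ε) (g := f - ε - ℓ)
      (by linarith) (by linarith)
    have h6 : 0 ≤ (gauge w d)⁻¹ * gauge w ε := by positivity
    have h7 : 0 ≤ (gauge w ℓ)⁻¹ * gauge w ε := by positivity
    nlinarith

theorem exists_sub_le_gauge (hℓ0 : 0 < ℓ) (hℓ1 : ℓ < 1 / 2) (hw0 : 0 < w) (hw1 : w < 1 / 2) :
    ∃ K, 0 < K ∧ ∀ f ≤ 1, ∀ ε, 0 < ε → Q ℓ w f - Q ℓ w (f - ε) ≤ K * gauge w ε := by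
  have hw1' : w < 1 := by linarith
  obtain ⟨j, hj⟩ := exists_level hℓ0 (1 - ℓ)
  have hd0 : 0 < min (ℓ / 2) (1 - 2 * ℓ) := lt_min (by linarith) (by linarith)
  have himp {δ H : ℝ} := IncrementsLe.improve (δ := δ) (H := H) hℓ0 hℓ1 hw0 hw1 hd0
    (min_le_left _ _) (min_le_right _ _) hj
  have hC : 0 < (gauge w ℓ)⁻¹ + (gauge w ℓ)⁻¹ + (gauge w (min (ℓ / 2) (1 - 2 * ℓ)))⁻¹ := by
    have := gauge_pos hw1' ℓ
    have := gauge_pos hw1' (min (ℓ / 2) (1 - 2 * ℓ))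
    positivity
  generalize (gauge w ℓ)⁻¹ + (gauge w ℓ)⁻¹ + (gauge w (min (ℓ / 2) (1 - 2 * ℓ)))⁻¹ = C at himp hC
  have hρ0 := levelWeight_pos hw0 hw1 j
  have hρ1 := levelWeight_lt_one hw1 j
  generalize levelWeight w j = ρ at himp hρ0 hρ1
  have hK : 0 < C / (1 - ρ) := div_pos hC (by linarith)
  have hKC : ρ * (C / (1 - ρ)) + C = C / (1 - ρ) := by
    have : 1 - ρ ≠ 0 := by linarith
    field_simp
    ring
  refine ⟨C / (1 - ρ), hK, fun f hf ε hε => ?_⟩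
  have hg := gauge_pos hw1' ε
  -- At fixed `ε` the trivial bound gives a finite start. The map `H ↦ ρ H + C` contracts to its
  -- fixed point `C / (1 - ρ)`, so letting `n → ∞` removes the dependence on `ε`.
  have iter (n : ℕ) : IncrementsLe ℓ w ε (C / (1 - ρ) + ρ ^ n * (gauge w ε)⁻¹) := by
    induction n with
    | zero =>
      intro f hf η hη
      have h1 := one_le_gauge_div hw0.le hw1' hε hη
      have h2 := gauge_pos hw1' η
      have h3 := sub_le_one (ℓ := ℓ) hw0 hw1' f (f - η)
      rw [pow_zero, one_mul]
      nlinarith [mul_pos hK h2]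
    | succ n ih =>
      have := himp hε (by positivity) ih
      convert this using 1
      rw [pow_succ]
      linarith
  have hlim : Filter.Tendsto (fun n : ℕ => (C / (1 - ρ) + ρ ^ n * (gauge w ε)⁻¹) * gauge w ε)
      Filter.atTop (nhds ((C / (1 - ρ) + 0 * (gauge w ε)⁻¹) * gauge w ε)) :=
    (((tendsto_pow_atTop_nhds_zero_of_lt_one hρ0.le hρ1).mul_const _).const_add _).mul_const _
  rw [zero_mul, add_zero] at hlim
  exact ge_of_tendsto' hlim fun n => iter n f hf ε le_rfl

/-! ### Fortunes that do not lead to `1 - ℓ` -/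

/-- On small scales the increments of `Q` below `f` are at most `c` times the gauge. -/
def EventuallyLe (ℓ w c f : ℝ) : Prop :=
  ∃ δ : ℝ, 0 < δ ∧ ∀ ε, 0 < ε → ε < δ → Q ℓ w f - Q ℓ w (f - ε) ≤ c * gauge w ε

/-- The threshold may depend on `f`, so windows are taken too short to straddle a breakpoint and no
additive error appears. Successors of a fortune off `S` used here are again off `S`. -/
theorem EventuallyLe.improve_of_le_one_sub (hℓ0 : 0 < ℓ) (hℓ1 : ℓ < 1 / 2) (hw0 : 0 < w)
    (hw1 : w < 1 / 2) {c : ℝ} (hc : 0 ≤ c)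
    (h : ∀ f, 0 ≤ f → f < 1 → f ∉ S ℓ w → EventuallyLe ℓ w c f) (j : ℕ) :
    ∀ f, 0 ≤ f → f ≤ 1 - ℓ → f ≤ (j + 1) * ℓ → f ∉ S ℓ w →
      EventuallyLe ℓ w (levelWeight w j * c) f := by
  have hw1' : w < 1 := by linarith
  have hq : 0 < 1 - w := by linarith
  have low (f : ℝ) (h0 : 0 ≤ f) (hf : f ≤ ℓ) (hfS : f ∉ S ℓ w) (i : ℕ) :
      EventuallyLe ℓ w (levelWeight w i * c) f := by
    obtain ⟨δ, hδ, hδ'⟩ := h (2 * f) (by linarith) (by linarith)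
      fun h2 => hfS (mem_S_of_two_mul hℓ1 hw0 hw1' hf h2)
    refine ⟨δ / 2, by positivity, fun ε hε hεδ => ?_⟩
    have hg := gauge_pos hw1' ε
    rw [sub_of_le hℓ0 hℓ1 hw0 hw1' hε hf]
    calc _ ≤ w * (c * gauge w (2 * ε)) :=
          mul_le_mul_of_nonneg_left (hδ' _ (by linarith) (by linarith)) hw0.le
      _ = w / (1 - w) * c * gauge w ε := by
          rw [mul_left_comm, mul_gauge_two_mul_eq_div hw1' hε]
          ring
      _ ≤ _ := by
          gcongr
          exact le_levelWeight hw0 hw1 i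
  induction j with
  | zero => exact fun f h0 _ hfj hfS => low f h0 (by simpa using hfj) hfS 0
  | succ j ih =>
    intro f h0 hf hfj hfS
    rcases le_or_gt f ℓ with hl | hl
    · exact low f h0 hl hfS _
    -- From `1 - ℓ` a win would land on `1`, which the hypothesis on fortunes below `1` does not
    -- cover.
    have hf' : f < 1 - ℓ := hf.lt_of_ne fun h => hfS (h ▸ one_sub_mem_S hℓ0 hℓ1 hw0 hw1')
    push_cast at hfj
    obtain ⟨δ₁, hδ₁, h₁⟩ := h (f + ℓ) (by linarith) (by linarith)
      fun h2 => hfS (mem_S_of_add hℓ0 hw0 hw1' hl.le hf h2)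
    obtain ⟨δ₂, hδ₂, h₂⟩ := ih (f - ℓ) (by linarith) (by linarith) (by linarith)
      fun h2 => hfS (mem_S_of_sub hℓ0 hw0 hw1' hl.le hf h2)
    refine ⟨min (min δ₁ δ₂) (f - ℓ), lt_min (lt_min hδ₁ hδ₂) (by linarith), fun ε hε hεδ => ?_⟩
    rw [lt_min_iff, lt_min_iff] at hεδ
    rw [sub_of_mem hℓ0 hw0 hw1' hε (by linarith) hf, levelWeight_succ]
    have h3 := mul_le_mul_of_nonneg_left (h₁ ε hε hεδ.1.1) hw0.le
    have h4 := mul_le_mul_of_nonneg_left (h₂ ε hε hεδ.1.2) hq.le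
    linarith

theorem EventuallyLe.improve (hℓ0 : 0 < ℓ) (hℓ1 : ℓ < 1 / 2) (hw0 : 0 < w) (hw1 : w < 1 / 2)
    {j : ℕ} (hj : 1 - ℓ ≤ (j + 1) * ℓ) {c : ℝ} (hc : 0 ≤ c)
    (h : ∀ f, 0 ≤ f → f < 1 → f ∉ S ℓ w → EventuallyLe ℓ w c f) {f : ℝ} (h0 : 0 ≤ f) (h1 : f < 1)
    (hf : f ∉ S ℓ w) : EventuallyLe ℓ w (levelWeight w j * c) f := by
  have hw1' : w < 1 := by linarith
  have hq : 0 < 1 - w := by linarith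
  -- Losses double the distance `η` to the goal until it is at least `ℓ`; the relative increments do
  -- not change on the way.
  suffices key : ∀ η : ℝ, 0 < η → η ≤ 1 → 1 - η ∉ S ℓ w →
      EventuallyLe ℓ w (levelWeight w j * c) (1 - η) by
    have := key (1 - f) (by linarith) (by linarith)
    rw [sub_sub_cancel] at this
    exact this hf
  intro η hη
  refine doubling_induction (a := ℓ) (P := fun η => η ≤ 1 → 1 - η ∉ S ℓ w →
      EventuallyLe ℓ w (levelWeight w j * c) (1 - η))
    (fun η hη hη1 hS => ?_) (fun η hη hηℓ ih _ hS => ?_) hη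
  · exact improve_of_le_one_sub hℓ0 hℓ1 hw0 hw1 hc h j _ (by linarith) (by linarith)
      (by linarith) hS
  · have htwo : 2 * (1 - η) - 1 = 1 - 2 * η := by ring
    obtain ⟨δ, hδ, hδ'⟩ := ih (by linarith) fun h2 =>
      hS (mem_S_of_two_mul_sub_one hℓ1 hw0 hw1' (by linarith) (by rwa [htwo]))
    refine ⟨min (δ / 2) (ℓ - η), lt_min (by positivity) (by linarith), fun ε hε hεδ => ?_⟩
    rw [lt_min_iff] at hεδ
    rw [sub_of_ge hℓ0 hℓ1 hw0 hw1' hε (by linarith), htwo, ← mul_gauge_two_mul hw1' hε,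
      mul_left_comm]
    exact mul_le_mul_of_nonneg_left (hδ' _ (by linarith) (by linarith)) hq.le

theorem eventuallyLe_of_notMem_S (hℓ0 : 0 < ℓ) (hℓ1 : ℓ < 1 / 2) (hw0 : 0 < w) (hw1 : w < 1 / 2)
    {f : ℝ} (h0 : 0 ≤ f) (h1 : f < 1) (hf : f ∉ S ℓ w) {C : ℝ} (hC : 0 < C) :
    EventuallyLe ℓ w C f := by
  obtain ⟨K, hK, hbound⟩ := exists_sub_le_gauge hℓ0 hℓ1 hw0 hw1
  obtain ⟨j, hj⟩ := exists_level hℓ0 (1 - ℓ)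
  have hρ0 := levelWeight_pos hw0 hw1 j
  have hρ1 := levelWeight_lt_one hw1 j
  have iter (n : ℕ) : ∀ f, 0 ≤ f → f < 1 → f ∉ S ℓ w →
      EventuallyLe ℓ w (levelWeight w j ^ n * K) f := by
    induction n with
    | zero =>
      intro f _ h1 _
      exact ⟨1, one_pos, fun ε hε _ => by simpa using hbound f h1.le ε hε⟩
    | succ n ih =>
      intro f h0 h1 hf
      rw [pow_succ', mul_assoc]
      exact EventuallyLe.improve hℓ0 hℓ1 hw0 hw1 hj (by positivity) ih h0 h1 hf
  obtain ⟨n, hn⟩ := exists_pow_lt_of_lt_one (div_pos hC hK) hρ1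
  obtain ⟨δ, hδ, h⟩ := iter n f h0 h1 hf
  refine ⟨δ, hδ, fun ε hε hεδ => (h ε hε hεδ).trans ?_⟩
  have hg := gauge_pos (show w < 1 by linarith) ε
  gcongr
  exact ((lt_div_iff₀ hK).1 hn).le

/-! ### Irrational limits -/

theorem eq_zero_of_eq_mul_irrational (hirr : Irrational ℓ) {m n : ℤ} (h : (m : ℝ) = n * ℓ) :
    m = 0 ∧ n = 0 := by
  rcases eq_or_ne n 0 with rfl | hn
  · simpa using h
  · exact absurd h.symm ((hirr.intCast_mul hn).ne_int m)

/-- Integer coordinates of a fortune in `S` relative to `ℓ` and a dyadic fraction of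
`y = 1 - (N - 1) ℓ`, where `N` is the integer part of `1 / ℓ`. -/
theorem coordinates_of_mem_S (hℓ0 : 0 < ℓ) (hℓ1 : ℓ < 1 / 2) (hw0 : 0 < w) (hw1 : w < 1)
    (hirr : Irrational ℓ) {N : ℤ} (hN2 : 2 ≤ N) (hN : N * ℓ < 1) (hN' : 1 < (N + 1) * ℓ) {z : ℝ}
    (hz : z ∈ S ℓ w) :
    ∀ (k : ℕ) (A B : ℤ), z = A + B * ℓ + (1 - (N - 1) * ℓ) / 2 ^ k →
      A = 0 ∧ 0 ≤ B ∧ B ≤ N - 1 := by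
  have hy0 : 0 < 1 - (N - 1) * ℓ := by linarith
  have hy (k : ℕ) : 0 < (1 - (N - 1) * ℓ) / 2 ^ k := by positivity
  have hy' (k : ℕ) : (1 - (N - 1) * ℓ) / 2 ^ k < 2 * ℓ :=
    (div_le_self hy0.le (one_le_pow₀ one_le_two)).trans_lt (by linarith)
  have half (k : ℕ) :
      2 * ((1 - (N - 1) * ℓ) / 2 ^ (k + 1)) = (1 - (N - 1) * ℓ) / 2 ^ k := by
    rw [pow_succ]
    field_simp
  refine S_induction_cases hℓ0 hℓ1 hw0 hw1 (P := fun z => ∀ (k : ℕ) (A B : ℤ),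
    z = A + B * ℓ + (1 - (N - 1) * ℓ) / 2 ^ k → A = 0 ∧ 0 ≤ B ∧ B ≤ N - 1)
    (fun k A B h => ?_) (fun z _ h1 ih k A B h => ?_) (fun z h1 h2 ih k A B h => ?_)
    (fun z h1 h2 ih k A B h => ?_) (fun z h1 h2 ih k A B h => ?_) hz
  -- By irrationality both integer coefficients vanish; the parity of `2 ^ k * (A - 1) + 1` then
  -- forces `k = 0`.
  · have hk : (2 : ℝ) ^ k ≠ 0 := by positivity
    have h' : ((2 ^ k * (A - 1) + 1 : ℤ) : ℝ) = ((N - 1 - 2 ^ k * (B + 1) : ℤ) : ℝ) * ℓ := by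
      push_cast
      field_simp at h
      linarith
    obtain ⟨h3, h4⟩ := eq_zero_of_eq_mul_irrational hirr h'
    cases k with
    | zero => simp only [pow_zero, one_mul] at h3 h4; omega
    | succ k => rw [pow_succ', mul_assoc] at h3; omega
  -- For `k = 0`, doubling uses `2y = 1 - (N - 1) ℓ + y` and makes the first coordinate odd, hence
  -- nonzero.
  · cases k with
    | zero =>
      have := (ih 0 (2 * A + 1) (2 * B - (N - 1)) (by rw [h]; push_cast; ring)).1
      omega
    | succ k =>
      have h3 := ih k (2 * A) (2 * B) (by rw [h, mul_add, half]; push_cast; ring)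
      have hA : A = 0 := by omega
      have hB : (B : ℝ) < 1 := by
        rw [hA, Int.cast_zero, zero_add] at h
        have := hy (k + 1)
        by_contra! hB
        nlinarith
      have : B < 1 := by exact_mod_cast hB
      omega
  · have h3 := ih k A (B + 1) (by rw [h]; push_cast; ring)
    -- Otherwise `z = y / 2 ^ k - ℓ < ℓ`.
    have hB : B ≠ -1 := by
      rintro rfl
      have := hy' k
      rw [h3.1] at h
      push_cast at h
      linarith
    omega
  · have h3 := ih k A (B - 1) (by rw [h]; push_cast; ring)
    -- Otherwise `z > N ℓ > 1 - ℓ`.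
    have hB : B ≠ N := by
      rintro rfl
      have := hy k
      rw [h3.1] at h
      push_cast at h
      linarith
    omega
  · cases k with
    | zero =>
      have h3 := ih 0 (2 * A) (2 * B - (N - 1)) (by rw [h]; push_cast; ring)
      have hA : A = 0 := by omega
      have hB : (B : ℝ) < N - 1 := by
        rw [hA, Int.cast_zero, zero_add, pow_zero, div_one] at h
        by_contra! hB
        nlinarith
      have : B < N - 1 := by exact_mod_cast hB
      omega
    | succ k =>
      have := (ih k (2 * A - 1) (2 * B) (by rw [h, mul_add, mul_add, half]; push_cast; ring)).1
      omega

theorem one_sub_mul_mem_S (hℓ0 : 0 < ℓ) (hℓ1 : ℓ < 1 / 2) (hw0 : 0 < w) (hw1 : w < 1) (m : ℕ)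
    (hm : (m + 2) * ℓ ≤ 1) : 1 - (m + 1) * ℓ ∈ S ℓ w := by
  induction m with
  | zero => simpa using one_sub_mem_S hℓ0 hℓ1 hw0 hw1
  | succ m ih =>
    push_cast at hm ⊢
    have hmℓ : 0 ≤ m * ℓ := by positivity
    refine mem_S_of_add hℓ0 hw0 hw1 (by linarith) (by linarith) ?_
    convert ih (by linarith) using 1
    ring

theorem div_two_pow_mem_S (hℓ1 : ℓ < 1 / 2) (hw0 : 0 < w) (hw1 : w < 1) {y : ℝ}
    (hy : y ∈ S ℓ w) (hyℓ : y ≤ 2 * ℓ) (n : ℕ) : y / 2 ^ n ∈ S ℓ w := by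
  induction n with
  | zero => simpa using hy
  | succ n ih =>
    have h : 2 * (y / 2 ^ (n + 1)) = y / 2 ^ n := by
      rw [pow_succ]
      field_simp
    refine mem_S_of_two_mul hℓ1 hw0 hw1 ?_ (by rwa [h])
    have : y / 2 ^ n ≤ y := div_le_self hy.1.1 (one_le_pow₀ one_le_two)
    linarith

theorem add_mul_mem_S (hℓ0 : 0 < ℓ) (hw0 : 0 < w) (hw1 : w < 1) {x : ℝ} (hx : x ∈ S ℓ w) (m : ℕ)
    (hm : x + m * ℓ ≤ 1 - ℓ) : x + m * ℓ ∈ S ℓ w := by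
  induction m with
  | zero => simpa using hx
  | succ m ih =>
    push_cast at hm ⊢
    have hmℓ : 0 ≤ m * ℓ := by positivity
    refine mem_S_of_sub hℓ0 hw0 hw1 (by linarith [hx.1.1]) hm ?_
    convert ih (by linarith) using 1
    ring

theorem exists_sub_mem_S_add_notMem_S (hℓ0 : 0 < ℓ) (hℓ1 : ℓ < 1 / 2) (hw0 : 0 < w) (hw1 : w < 1)
    (hirr : Irrational ℓ) : ∃ f ∈ Set.Ioo ℓ (1 - ℓ), f - ℓ ∈ S ℓ w ∧ f + ℓ ∉ S ℓ w := by
  obtain ⟨M, hN, hN'⟩ : ∃ M : ℕ, (M + 2) * ℓ < 1 ∧ 1 < (M + 3) * ℓ := by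
    have h2 : 2 ≤ ⌊1 / ℓ⌋₊ := Nat.le_floor (by rw [le_div_iff₀ hℓ0]; push_cast; linarith)
    obtain ⟨M, hM⟩ := Nat.exists_eq_add_of_le' h2
    have h3 : ((M + 2 : ℕ) : ℝ) ≤ 1 / ℓ := hM ▸ Nat.floor_le (by positivity)
    have h4 := Nat.lt_floor_add_one (1 / ℓ)
    rw [hM, div_lt_iff₀ hℓ0] at h4
    rw [le_div_iff₀ hℓ0] at h3
    push_cast at h3 h4
    refine ⟨M, h3.lt_of_ne fun h => ?_, by linarith⟩
    have := (eq_zero_of_eq_mul_irrational hirr (m := 1) (n := M + 2) (by push_cast; linarith)).1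
    omega
  have hM : (0 : ℝ) ≤ M * ℓ := by positivity
  have hy := one_sub_mul_mem_S hℓ0 hℓ1 hw0 hw1 M hN.le
  have hy0 : 0 < 1 - (M + 1) * ℓ := by linarith
  -- Here `N = M + 2`; this choice of `n` gives `f + ℓ < 1`.
  obtain ⟨n, hn⟩ : ∃ n : ℕ, (1 - (M + 1) * ℓ) / 2 ^ n < 1 - (M + 2) * ℓ := by
    obtain ⟨n, hn⟩ := pow_unbounded_of_one_lt ((1 - (M + 1) * ℓ) / (1 - (M + 2) * ℓ)) one_lt_two
    refine ⟨n, ?_⟩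
    rw [div_lt_iff₀ (by linarith)] at hn
    rw [div_lt_iff₀ (by positivity)]
    linarith
  have hx := div_two_pow_mem_S hℓ1 hw0 hw1 hy (by linarith) n
  have hx0 : 0 < (1 - (M + 1) * ℓ) / 2 ^ n := by positivity
  refine ⟨(1 - (M + 1) * ℓ) / 2 ^ n + (M + 1) * ℓ, ⟨by linarith, by linarith⟩, ?_, fun h => ?_⟩
  · convert add_mul_mem_S hℓ0 hw0 hw1 hx M (by linarith) using 1
    ring
  · have := (coordinates_of_mem_S hℓ0 hℓ1 hw0 hw1 hirr (N := M + 2) (by omega)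
      (by push_cast; linarith) (by push_cast; linarith) h n 0 (M + 2)
      (by push_cast; ring)).2.2
    omega

end BoldPlay

theorem mainTheorem2 (ℓ w : ℝ) (hℓ0 : 0 < ℓ) (hℓ1 : ℓ < 1 / 2) (hw0 : 0 < w) (hw1 : w < 1 / 2) :
    (∀ f ∈ BoldPlay.S ℓ w, ∃ C : ℝ, 0 < C ∧ ∀ ε : ℝ, 0 < ε → ε < ℓ →
      C * (1 - w) ^ (-Real.logb 2 ε) ≤ BoldPlay.Q ℓ w f - BoldPlay.Q ℓ w (f - ε)) ∧
    (∀ f : ℝ, 0 ≤ f → f < 1 → f ∉ BoldPlay.S ℓ w → ∀ C : ℝ, 0 < C → ∃ δ : ℝ, 0 < δ ∧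
      ∀ ε : ℝ, 0 < ε → ε < δ →
        BoldPlay.Q ℓ w f - BoldPlay.Q ℓ w (f - ε) ≤ C * (1 - w) ^ (-Real.logb 2 ε)) ∧
    (Irrational ℓ → ∃ f ∈ Set.Ioo ℓ (1 - ℓ),
      f - ℓ ∈ BoldPlay.S ℓ w ∧ f + ℓ ∉ BoldPlay.S ℓ w) := by
  have hw1' : w < 1 := by linarith
  exact ⟨fun f hf => BoldPlay.exists_gauge_le_sub hℓ0 hℓ1 hw0 hw1' hf,
    fun f h0 h1 hf C hC => BoldPlay.eventuallyLe_of_notMem_S hℓ0 hℓ1 hw0 hw1 h0 h1 hf hC,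
    BoldPlay.exists_sub_mem_S_add_notMem_S hℓ0 hℓ1 hw0 hw1'⟩
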